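/- Let $N\in\mathbb N$, $0<s<1$, $2s<N$, put $2_s^*=\frac{2N}{N-2s}$, and let $2<q<\nu<2_s^*$. Let $D^s(\mathbb R^N)$ be the space of all $u\in L^{2_s^*}(\mathbb R^N)$ with $\iint_{\mathbb R^{2N}}\frac{|u(x)-u(y)|^2}{|x-y|^{N+2s}}\,dx\,dy<\infty$. Put $\eta_0=\frac{2_s^*}{2_s^*-q}$ and $\eta=\frac{\nu}{\nu-1}\,\frac{2_s^*}{2_s^*-q}$. Let $w:\mathbb R^N\to\mathbb R$ satisfy (W$_1$) there is a nonempty open set $\Omega\subset\mathbb R^N$ such that $w>0$ a.e. in $\Omega$; (W$_2$) $w\in L^\tau(\mathbb R^N)$ for all $\tau\in[\eta_0,\eta]$. For $\lambda>0$, a function $u\in D^s(\mathbb R^N)$ is called a weak solution of $(-\Delta)^su=\lambda w|u|^{q-2}u$ in $\mathbb R^N$ if $$\iint_{\mathbb R^{2N}}\frac{(u(x)-u(y))(\varphi(x)-\varphi(y))}{|x-y|^{N+2s}}\,dx\,dy=\lambda\int_{\mathbb R^N}w|u|^{q-2}u\,\varphi\,dx\qquad\text{for all }\varphi\in D^s(\mathbb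 R^N).$$ Then every such weak solution $u$ (for any $\lambda>0$) belongs to $L^\kappa(\mathbb R^N)$ for every $\kappa\in[2_s^*,\infty]$. Moreover, $\|u\|_\infty\le C\|u\|_{2_s^*}$ with a constant $C$ that depends only on $N,s,q,\nu$ and on upper bounds for $\lambda$, $\|w\|_\eta$ and $\|u\|_{2_s^*}$. -/

import Mathlib

open MeasureTheory
open scoped NNReal ENNReal

/-- The critical exponent `2_s^* = 2N / (N - 2s)`. -/
noncomputable def critExp (N : ℕ) (s : ℝ) : ℝ := 2 * N / (N - 2 * s)

/-- `(x, y) ↦ (u x - u y) / |x - y| ^ (N / 2 + s)`; it vanishes on the (null) diagonal. -/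
noncomputable def gagliardoQuotient {N : ℕ} (s : ℝ) (u : EuclideanSpace ℝ (Fin N) → ℝ)
    (z : EuclideanSpace ℝ (Fin N) × EuclideanSpace ℝ (Fin N)) : ℝ :=
  (u z.1 - u z.2) / ‖z.1 - z.2‖ ^ ((N : ℝ) / 2 + s)

/-- `u ∈ D^s(ℝ^N)`: `u` lies in `L^{2_s^*}(ℝ^N)` and its Gagliardo quotient lies in
`L^2(ℝ^N × ℝ^N)`. -/
def MemDs {N : ℕ} (s : ℝ) (u : EuclideanSpace ℝ (Fin N) → ℝ) : Prop :=
  MemLp u (ENNReal.ofReal (critExp N s)) volume ∧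
    MemLp (gagliardoQuotient s u) 2 (volume.prod volume)

/-- `u ∈ D^s(ℝ^N)` is a weak solution of `(-Δ)^s u = lam * w * |u|^(q-2) * u` in `ℝ^N`, tested
against all of `D^s(ℝ^N)`. -/
def IsWeakSolution {N : ℕ} (s q lam : ℝ) (w u : EuclideanSpace ℝ (Fin N) → ℝ) : Prop :=
  MemDs s u ∧ ∀ φ : EuclideanSpace ℝ (Fin N) → ℝ, MemDs s φ →
    ∫ z : EuclideanSpace ℝ (Fin N) × EuclideanSpace ℝ (Fin N),
        (u z.1 - u z.2) * (φ z.1 - φ z.2) / ‖z.1 - z.2‖ ^ ((N : ℝ) + 2 * s)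
          ∂(volume.prod volume) =
      lam * ∫ x, w x * |u x| ^ (q - 2) * u x * φ x

/-- The weight is positive almost everywhere in some nonempty open set. -/
def WeightPosOnOpen {N : ℕ} (w : EuclideanSpace ℝ (Fin N) → ℝ) : Prop :=
  ∃ Ω : Set (EuclideanSpace ℝ (Fin N)), IsOpen Ω ∧ Ω.Nonempty ∧
    ∀ᵐ x ∂(volume.restrict Ω), 0 < w x

/-- The lower integrability exponent `2_s^* / (2_s^* - q)` of the weight. -/
noncomputable def weightExpLow (N : ℕ) (s q : ℝ) : ℝ := critExp N s / (critExp N s - q)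

/-- The upper integrability exponent `ν / (ν - 1) * (2_s^* / (2_s^* - q))` of the weight. -/
noncomputable def weightExpHigh (N : ℕ) (s q ν : ℝ) : ℝ := ν / (ν - 1) * weightExpLow N s q

/-- The weight lies in `L^τ(ℝ^N)` for all `τ` between the two exponents. -/
def WeightIntegrability {N : ℕ} (s q ν : ℝ) (w : EuclideanSpace ℝ (Fin N) → ℝ) : Prop :=
  ∀ τ ∈ Set.Icc (weightExpLow N s q) (weightExpHigh N s q ν), MemLp w (ENNReal.ofReal τ) volume

/-! The proof is a De Giorgi iteration. Write `p` for the critical exponent, `τ` for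
`weightExpHigh`, `σ = p (1 - 1/τ)` and `U = ‖u‖_p`. Testing with `(u - k)₊` bounds its energy by `λ
∫ w |u|^(q-2) u (u - k)₊`. Sobolev's inequality (`MemDs.eLpNorm_sq_le`, proved by averaging over
balls) bounds the `L^p` norm of `(u - k)₊` by this energy. Where `u > k`, the excess over a lower
level dominates both `u` and `K` up to a factor (`abs_rpow_mul_max_le`), so Hölder bounds the
integral by the `σ`-th power of the norm `Y j` of the previous truncation. As `σ > 2`, the recursion
is superlinear and `Y j → 0` once its constant is small. With top level `K = M U` that constant
carries `M^(-(σ - q))`, and `σ - q = (p - q)/ν > 0`, so a large `M` suffices and `u ≤ M U`. The same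
bound for `-u` gives the sup bound; interpolation gives the other exponents. -/

theorem lintegral_enorm_rpow_eq_eLpNorm_rpow {α F : Type*} [MeasurableSpace α]
    [NormedAddCommGroup F] {μ : Measure α} (f : α → F) {p : ℝ} (hp : 0 < p) :
    ∫⁻ x, ‖f x‖ₑ ^ p ∂μ = eLpNorm f (ENNReal.ofReal p) μ ^ p := by
  rw [eLpNorm_eq_lintegral_rpow_enorm_toReal (by simpa using hp) ENNReal.ofReal_ne_top,
    ENNReal.toReal_ofReal hp.le, ← ENNReal.rpow_mul, one_div_mul_cancel hp.ne', ENNReal.rpow_one]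

section CriticalExponent

variable {N : ℕ} {s : ℝ}

theorem natCast_pos_of_two_mul_lt (hs0 : 0 < s) (hsN : 2 * s < N) : (0 : ℝ) < N := by linarith

theorem two_lt_critExp (hs0 : 0 < s) (hsN : 2 * s < N) : 2 < critExp N s := by
  rw [critExp, lt_div_iff₀ (by linarith)]
  linarith

theorem one_add_two_mul_div_eq (hs0 : 0 < s) (hsN : 2 * s < N) :
    1 + 2 * s / N = 2 - 2 / critExp N s := by
  have h1 : (N : ℝ) ≠ 0 := (natCast_pos_of_two_mul_lt hs0 hsN).ne'
  have h2 : (N : ℝ) - 2 * s ≠ 0 := by linarith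
  rw [critExp]
  field_simp
  ring

end CriticalExponent

/-! ### Fractional Sobolev inequality. -/

section Gagliardo

variable {N : ℕ} {s : ℝ}

theorem gagliardoQuotient_mul (u v : EuclideanSpace ℝ (Fin N) → ℝ)
    (z : EuclideanSpace ℝ (Fin N) × EuclideanSpace ℝ (Fin N)) :
    gagliardoQuotient s u z * gagliardoQuotient s v z =
      (u z.1 - u z.2) * (v z.1 - v z.2) / ‖z.1 - z.2‖ ^ ((N : ℝ) + 2 * s) := by
  rw [gagliardoQuotient, gagliardoQuotient, div_mul_div_comm, ← sq, ← Real.rpow_natCast,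
    ← Real.rpow_mul (norm_nonneg _)]
  congr 2
  push_cast
  ring

theorem enorm_sub_sq_le_gagliardoQuotient (hs0 : 0 < s) (u : EuclideanSpace ℝ (Fin N) → ℝ)
    {x y : EuclideanSpace ℝ (Fin N)} {r : ℝ} (hxy : ‖x - y‖ ≤ r) :
    ‖u x - u y‖ₑ ^ 2 ≤
      ENNReal.ofReal (r ^ ((N : ℝ) + 2 * s)) * ‖gagliardoQuotient s u (x, y)‖ₑ ^ 2 := by
  have key : (u x - u y) ^ 2 ≤ r ^ ((N : ℝ) + 2 * s) * gagliardoQuotient s u (x, y) ^ 2 := by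
    rcases eq_or_ne x y with rfl | hne
    · simp [gagliardoQuotient]
    · have hpos : 0 < ‖x - y‖ := norm_pos_iff.2 (sub_ne_zero.2 hne)
      rw [sq (gagliardoQuotient s u (x, y)), gagliardoQuotient_mul, ← sq, ← mul_div_assoc,
        le_div_iff₀ (by positivity), mul_comm]
      gcongr
  have hr : 0 ≤ r := (norm_nonneg _).trans hxy
  have h := ENNReal.ofReal_le_ofReal key
  rw [ENNReal.ofReal_mul (by positivity), ← sq_abs, ← sq_abs (gagliardoQuotient _ _ _),
    ENNReal.ofReal_pow (abs_nonneg _), ENNReal.ofReal_pow (abs_nonneg _)] at h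
  simpa only [Real.enorm_eq_ofReal_abs] using h

theorem lintegral_ball_enorm_sq_le {u : EuclideanSpace ℝ (Fin N) → ℝ} {p : ℝ} (hp : 2 < p)
    (hu : AEStronglyMeasurable u) (x : EuclideanSpace ℝ (Fin N)) (r : ℝ) :
    ∫⁻ y in Metric.ball x r, ‖u y‖ₑ ^ 2 ≤
      eLpNorm u (ENNReal.ofReal p) volume ^ 2 * volume (Metric.ball x r) ^ (1 - 2 / p) := by
  have h2p : (2 : ℝ≥0∞) ≤ ENNReal.ofReal p := by
    rw [← ENNReal.ofReal_ofNat]; exact ENNReal.ofReal_le_ofReal hp.le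
  have h := eLpNorm_le_eLpNorm_mul_rpow_measure_univ (μ := volume.restrict (Metric.ball x r))
    h2p hu.restrict
  rw [Measure.restrict_apply_univ, ENNReal.toReal_ofReal (by linarith), ENNReal.toReal_ofNat] at h
  have h' := pow_le_pow_left₀ zero_le h 2
  have e := lintegral_enorm_rpow_eq_eLpNorm_rpow (μ := volume.restrict (Metric.ball x r)) u
    (p := 2) two_pos
  simp only [ENNReal.rpow_ofNat, ENNReal.ofReal_ofNat] at e
  rw [e]
  refine h'.trans ?_
  rw [mul_pow, ← ENNReal.rpow_natCast (_ ^ (1 / (2 : ℝ) - 1 / p)), ← ENNReal.rpow_mul]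
  have : (1 / (2 : ℝ) - 1 / p) * ((2 : ℕ) : ℝ) = 1 - 2 / p := by push_cast; ring
  rw [this]
  gcongr
  exact Measure.restrict_le_self

/-- Integrate `|u x|² ≤ 2 |u x - u y|² + 2 |u y|²` over `y` in the ball; Hölder handles the last
term. -/
theorem enorm_sq_mul_volume_ball_le (hs0 : 0 < s) {p : ℝ} (hp : 2 < p)
    {u : EuclideanSpace ℝ (Fin N) → ℝ} (hu : AEStronglyMeasurable u)
    (x : EuclideanSpace ℝ (Fin N)) (r : ℝ) :
    ‖u x‖ₑ ^ 2 * volume (Metric.ball x r) ≤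
      2 * (ENNReal.ofReal (r ^ ((N : ℝ) + 2 * s)) *
        ∫⁻ y, ‖gagliardoQuotient s u (x, y)‖ₑ ^ 2) +
      2 * (eLpNorm u (ENNReal.ofReal p) volume ^ 2 *
        volume (Metric.ball x r) ^ (1 - 2 / p)) := by
  calc ‖u x‖ₑ ^ 2 * volume (Metric.ball x r)
      = ∫⁻ _ in Metric.ball x r, ‖u x‖ₑ ^ 2 := by rw [setLIntegral_const]
    _ ≤ ∫⁻ y in Metric.ball x r, (2 * (ENNReal.ofReal (r ^ ((N : ℝ) + 2 * s)) *
          ‖gagliardoQuotient s u (x, y)‖ₑ ^ 2) + 2 * ‖u y‖ₑ ^ 2) := by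
        refine setLIntegral_mono' measurableSet_ball fun y hy => ?_
        have hxy : ‖x - y‖ ≤ r := by
          rw [← dist_eq_norm, dist_comm]; exact (Metric.mem_ball.1 hy).le
        have hsplit : ‖u x‖ₑ ^ 2 ≤ 2 * ‖u x - u y‖ₑ ^ 2 + 2 * ‖u y‖ₑ ^ 2 := by
          have hr : u x ^ 2 ≤ 2 * (u x - u y) ^ 2 + 2 * u y ^ 2 := by
            nlinarith [sq_nonneg (u x - 2 * u y)]
          have h := ENNReal.ofReal_le_ofReal hr
          rw [ENNReal.ofReal_add (by positivity) (by positivity),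
            ENNReal.ofReal_mul zero_le_two, ENNReal.ofReal_mul zero_le_two,
            ← sq_abs, ← sq_abs (u x - u y), ← sq_abs (u y),
            ENNReal.ofReal_pow (abs_nonneg _), ENNReal.ofReal_pow (abs_nonneg _),
            ENNReal.ofReal_pow (abs_nonneg _), ENNReal.ofReal_ofNat] at h
          simpa only [Real.enorm_eq_ofReal_abs] using h
        refine hsplit.trans ?_
        gcongr
        exact enorm_sub_sq_le_gagliardoQuotient hs0 u hxy
    _ ≤ _ := by
        rw [lintegral_add_right' _ ((hu.restrict.enorm.pow_const 2).const_mul 2),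
          lintegral_const_mul' _ _ ENNReal.ofNat_ne_top,
          lintegral_const_mul' _ _ ENNReal.ofReal_ne_top,
          lintegral_const_mul' _ _ ENNReal.ofNat_ne_top]
        gcongr
        · exact Measure.restrict_le_self
        · exact lintegral_ball_enorm_sq_le hp hu x r

/-- For a ball of volume `(2U/a)^p` the `U`-term is exactly half of the left side and is absorbed.
-/
theorem rpow_le_of_sq_mul_le {p m a U g : ℝ} (hp : 2 < p) (hm : 0 < m) (ha : 0 < a) (hU : 0 < U)
    (h : a ^ 2 * (2 * U / a) ^ p ≤ 2 * (((2 * U / a) ^ p / m) ^ (2 - 2 / p) * g) +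
      2 * (U ^ 2 * ((2 * U / a) ^ p) ^ (1 - 2 / p))) :
    a ^ p ≤ 4 * m ^ (-(2 - 2 / p)) * 2 ^ (p - 2) * U ^ (p - 2) * g := by
  have hp0 : p ≠ 0 := by linarith
  have hb : 0 < 2 * U / a := by positivity
  have e1 : ((2 * U / a) ^ p) ^ (1 - 2 / p) = (2 * U / a) ^ (p - 2) := by
    rw [← Real.rpow_mul hb.le]; congr 1; field_simp
  have e2 : ((2 * U / a) ^ p / m) ^ (2 - 2 / p) =
      (2 * U / a) ^ p * (2 * U / a) ^ (p - 2) * m ^ (-(2 - 2 / p)) := by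
    rw [Real.div_rpow (by positivity) hm.le, ← Real.rpow_mul hb.le, Real.rpow_neg hm.le,
      ← Real.rpow_add hb, div_eq_mul_inv]
    congr 2; field_simp; ring
  have e3 : (2 * U / a) ^ p = (2 * U / a) ^ (p - 2) * (2 * U / a) ^ 2 := by
    rw [← Real.rpow_natCast, ← Real.rpow_add hb]; congr 1; push_cast; ring
  have e4 : (2 * U / a) ^ (p - 2) = 2 ^ (p - 2) * U ^ (p - 2) / a ^ (p - 2) := by
    rw [Real.div_rpow (by positivity) ha.le, Real.mul_rpow zero_le_two hU.le]
  have e5 : a ^ p = a ^ (p - 2) * a ^ 2 := by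
    rw [← Real.rpow_natCast, ← Real.rpow_add ha]; congr 1; push_cast; ring
  have hT : 0 < (2 * U / a) ^ p := by positivity
  have e6 : 2 * (U ^ 2 * ((2 * U / a) ^ p) ^ (1 - 2 / p)) = a ^ 2 / 2 * (2 * U / a) ^ p := by
    rw [e1, e3]; field_simp
  rw [e6, e2] at h
  have h1 : a ^ 2 / 2 * (2 * U / a) ^ p ≤
      (2 * ((2 * U / a) ^ (p - 2) * m ^ (-(2 - 2 / p)) * g)) * (2 * U / a) ^ p := by linarith
  have h2 := le_of_mul_le_mul_right h1 hT
  rw [e4] at h2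
  have h3 : 0 < a ^ (p - 2) := by positivity
  have h4 := mul_le_mul_of_nonneg_left h2 h3.le
  rw [e5]
  have h5 : a ^ (p - 2) * (2 * (2 ^ (p - 2) * U ^ (p - 2) / a ^ (p - 2) *
      m ^ (-(2 - 2 / p)) * g)) = 2 * (2 ^ (p - 2) * U ^ (p - 2) * m ^ (-(2 - 2 / p)) * g) := by
    field_simp
  rw [h5] at h4
  linarith

/-- The constant in the fractional Sobolev inequality. -/
noncomputable def sobolevConst (N : ℕ) (s : ℝ) : ℝ :=
  4 * (volume (Metric.ball (0 : EuclideanSpace ℝ (Fin N)) 1)).toReal ^ (-(2 - 2 / critExp N s)) *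
    2 ^ (critExp N s - 2)

theorem volume_unit_ball_toReal_pos (N : ℕ) :
    0 < (volume (Metric.ball (0 : EuclideanSpace ℝ (Fin N)) 1)).toReal :=
  ENNReal.toReal_pos (Metric.measure_ball_pos volume _ one_pos).ne' measure_ball_lt_top.ne

theorem sobolevConst_pos (N : ℕ) (s : ℝ) : 0 < sobolevConst N s := by
  have := volume_unit_ball_toReal_pos N
  rw [sobolevConst]
  positivity

theorem enorm_rpow_le_lintegral_gagliardoQuotient (hs0 : 0 < s) (hsN : 2 * s < N)
    {u : EuclideanSpace ℝ (Fin N) → ℝ} (hu : AEStronglyMeasurable u) {U : ℝ} (hU : 0 < U)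
    (huU : eLpNorm u (ENNReal.ofReal (critExp N s)) volume = ENNReal.ofReal U)
    (x : EuclideanSpace ℝ (Fin N)) :
    ‖u x‖ₑ ^ critExp N s ≤ ENNReal.ofReal (sobolevConst N s * U ^ (critExp N s - 2)) *
      ∫⁻ y, ‖gagliardoQuotient s u (x, y)‖ₑ ^ 2 := by
  have hN : (0 : ℝ) < N := natCast_pos_of_two_mul_lt hs0 hsN
  have hp := two_lt_critExp hs0 hsN
  have hexp := one_add_two_mul_div_eq hs0 hsN
  have hS := sobolevConst_pos N s
  set p := critExp N s with hpdef
  set G := ∫⁻ y, ‖gagliardoQuotient s u (x, y)‖ₑ ^ 2 with hG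
  rcases eq_or_ne (u x) 0 with h0 | h0
  · simp [h0, ENNReal.zero_rpow_of_pos (show 0 < p by linarith)]
  rcases eq_or_ne G ∞ with hGtop | hGtop
  · rw [hGtop, ENNReal.mul_top]
    · exact le_top
    · simp only [ne_eq, ENNReal.ofReal_eq_zero, not_le]; positivity
  obtain ⟨g, hg, hgG⟩ : ∃ g : ℝ, 0 ≤ g ∧ G = ENNReal.ofReal g :=
    ⟨G.toReal, ENNReal.toReal_nonneg, (ENNReal.ofReal_toReal hGtop).symm⟩
  set m := (volume (Metric.ball (0 : EuclideanSpace ℝ (Fin N)) 1)).toReal with hm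
  have hmpos : 0 < m := volume_unit_ball_toReal_pos N
  have hmE : volume (Metric.ball (0 : EuclideanSpace ℝ (Fin N)) 1) = ENNReal.ofReal m :=
    (ENNReal.ofReal_toReal measure_ball_lt_top.ne).symm
  set a := |u x| with hadef
  have ha : 0 < a := abs_pos.2 h0
  have hax : ‖u x‖ₑ = ENNReal.ofReal a := Real.enorm_eq_ofReal_abs _
  set T := (2 * U / a) ^ p with hTdef
  have hT : 0 < T := by positivity
  -- The radius for which the ball has volume `T`.
  set r := (T / m) ^ (1 / (N : ℝ)) with hr
  have hr0 : 0 < r := by positivity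
  have hrN : r ^ N = T / m := by
    rw [hr, ← Real.rpow_natCast, ← Real.rpow_mul (by positivity), one_div_mul_cancel hN.ne',
      Real.rpow_one]
  have hrNs : r ^ ((N : ℝ) + 2 * s) = (T / m) ^ (2 - 2 / p) := by
    rw [hr, ← Real.rpow_mul (by positivity), ← hexp]
    congr 1; field_simp
  have : Nonempty (Fin N) := ⟨⟨0, by exact_mod_cast hN⟩⟩
  have hvol : volume (Metric.ball x r) = ENNReal.ofReal T := by
    rw [Measure.addHaar_ball volume x hr0.le, finrank_euclideanSpace_fin, hrN, hmE,
      ← ENNReal.ofReal_mul (by positivity), div_mul_cancel₀ _ hmpos.ne']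
  have key := enorm_sq_mul_volume_ball_le hs0 hp hu x r
  rw [← hG, hgG, hvol, hrNs, huU, hax, ← ENNReal.ofReal_pow ha.le,
    ← ENNReal.ofReal_mul (by positivity), ← ENNReal.ofReal_mul (by positivity),
    ENNReal.ofReal_rpow_of_pos hT, ← ENNReal.ofReal_pow hU.le,
    ← ENNReal.ofReal_mul (by positivity), ← ENNReal.ofReal_ofNat,
    ← ENNReal.ofReal_mul (by positivity), ← ENNReal.ofReal_mul (by positivity),
    ← ENNReal.ofReal_add (by positivity) (by positivity),
    ENNReal.ofReal_le_ofReal_iff (by positivity)] at key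
  have hfin := rpow_le_of_sq_mul_le hp hmpos ha hU key
  rw [hgG, hax, ENNReal.ofReal_rpow_of_pos ha, ← ENNReal.ofReal_mul (by positivity)]
  exact ENNReal.ofReal_le_ofReal hfin

theorem ofReal_integral_sq_eq_lintegral {α : Type*} [MeasurableSpace α] {μ : Measure α}
    {f : α → ℝ} (hf : MemLp f 2 μ) :
    ENNReal.ofReal (∫ x, f x ^ 2 ∂μ) = ∫⁻ x, ‖f x‖ₑ ^ 2 ∂μ := by
  rw [ofReal_integral_eq_lintegral_ofReal hf.integrable_sq (ae_of_all _ fun x => sq_nonneg _)]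
  refine lintegral_congr fun x => ?_
  rw [Real.enorm_eq_ofReal_abs, ← ENNReal.ofReal_pow (abs_nonneg _), sq_abs]

/-- The fractional Sobolev inequality on `D^s(ℝ^N)`. -/
theorem MemDs.eLpNorm_sq_le (hs0 : 0 < s) (hsN : 2 * s < N)
    {u : EuclideanSpace ℝ (Fin N) → ℝ} (hu : MemDs s u) :
    (eLpNorm u (ENNReal.ofReal (critExp N s)) volume).toReal ^ 2 ≤
      sobolevConst N s * ∫ z, gagliardoQuotient s u z ^ 2 ∂(volume.prod volume) := by
  have hp := two_lt_critExp hs0 hsN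
  have hS := sobolevConst_pos N s
  have hI : 0 ≤ ∫ z, gagliardoQuotient s u z ^ 2 ∂(volume.prod volume) :=
    integral_nonneg fun z => sq_nonneg _
  set p := critExp N s with hpdef
  set U := (eLpNorm u (ENNReal.ofReal p) volume).toReal with hUdef
  have huU : eLpNorm u (ENNReal.ofReal p) volume = ENNReal.ofReal U :=
    (ENNReal.ofReal_toReal hu.1.eLpNorm_ne_top).symm
  rcases (ENNReal.toReal_nonneg : 0 ≤ U).eq_or_lt with h0 | hU
  · rw [show U = 0 from h0.symm, zero_pow two_ne_zero]; positivity
  have h : ENNReal.ofReal (U ^ p) ≤ ENNReal.ofReal (sobolevConst N s * U ^ (p - 2) *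
      ∫ z, gagliardoQuotient s u z ^ 2 ∂(volume.prod volume)) := by
    rw [ENNReal.ofReal_mul (by positivity), ofReal_integral_sq_eq_lintegral hu.2,
      lintegral_prod _ (hu.2.1.enorm.pow_const 2), ← ENNReal.ofReal_rpow_of_pos hU, ← huU,
      ← lintegral_enorm_rpow_eq_eLpNorm_rpow u (by linarith),
      ← lintegral_const_mul' _ _ ENNReal.ofReal_ne_top]
    exact lintegral_mono fun x =>
      enorm_rpow_le_lintegral_gagliardoQuotient hs0 hsN hu.1.1 hU huU x
  rw [ENNReal.ofReal_le_ofReal_iff (by positivity)] at h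
  have e : U ^ p = U ^ 2 * U ^ (p - 2) := by
    rw [← Real.rpow_natCast, ← Real.rpow_add hU]; congr 1; push_cast; ring
  rw [e] at h
  -- The pointwise bound, integrated in `x`, carries the factor `U ^ (p - 2)` on the right; it
  -- cancels against `U ^ p`.
  refine le_of_mul_le_mul_right (a := U ^ (p - 2)) ?_ (by positivity)
  linarith

end Gagliardo

theorem lintegral_enorm_mul_enorm_rpow_le {α : Type*} [MeasurableSpace α] {μ : Measure α}
    {w f : α → ℝ} (hw : AEStronglyMeasurable w μ) (hf : AEStronglyMeasurable f μ) {p τ : ℝ}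
    (hp : 0 < p) (hτ : 1 < τ) :
    ∫⁻ x, ‖w x‖ₑ * ‖f x‖ₑ ^ (p * (1 - 1 / τ)) ∂μ ≤
      eLpNorm w (ENNReal.ofReal τ) μ *
        eLpNorm f (ENNReal.ofReal p) μ ^ (p * (1 - 1 / τ)) := by
  have hc : τ.HolderConjugate (τ / (τ - 1)) := Real.HolderConjugate.conjExponent hτ
  have hτ1 : 0 < τ - 1 := by linarith
  have hτ0 : 0 < τ := by linarith
  have h := ENNReal.lintegral_mul_le_Lp_mul_Lq μ hc hw.enorm
    (hf.enorm.pow_const (p * (1 - 1 / τ)))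
  refine h.trans (le_of_eq ?_)
  have e : p * (1 - 1 / τ) * (τ / (τ - 1)) = p := by field_simp
  simp_rw [← ENNReal.rpow_mul, e]
  rw [lintegral_enorm_rpow_eq_eLpNorm_rpow w hτ0, lintegral_enorm_rpow_eq_eLpNorm_rpow f hp,
    ← ENNReal.rpow_mul, ← ENNReal.rpow_mul, mul_one_div_cancel hτ0.ne', ENNReal.rpow_one]
  congr 2
  field_simp

/-! ### Truncations in `D^s` and their energy. -/

section Truncation

variable {N : ℕ} {s : ℝ}

theorem aestronglyMeasurable_gagliardoQuotient {u : EuclideanSpace ℝ (Fin N) → ℝ}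
    (hu : AEStronglyMeasurable u) :
    AEStronglyMeasurable (gagliardoQuotient s u) (volume.prod volume) := by
  have hd : Measurable fun z : EuclideanSpace ℝ (Fin N) × EuclideanSpace ℝ (Fin N) =>
      ‖z.1 - z.2‖ ^ ((N : ℝ) / 2 + s) := by fun_prop
  exact ((hu.comp_fst.sub hu.comp_snd).aemeasurable.div hd.aemeasurable).aestronglyMeasurable

theorem MemDs.neg {u : EuclideanSpace ℝ (Fin N) → ℝ} (hu : MemDs s u) :
    MemDs s (fun x => -u x) := by
  refine ⟨hu.1.neg, ?_⟩
  have e : gagliardoQuotient s (fun x => -u x) = -gagliardoQuotient s u := by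
    funext z
    simp only [gagliardoQuotient, Pi.neg_apply]
    ring
  rw [e]
  exact hu.2.neg

theorem MemDs.max_sub_zero {u : EuclideanSpace ℝ (Fin N) → ℝ} (hu : MemDs s u) {k : ℝ}
    (hk : 0 ≤ k) : MemDs s (fun x => max (u x - k) 0) := by
  have hm : AEStronglyMeasurable (fun x => max (u x - k) 0) :=
    ((hu.1.1.aemeasurable.sub_const k).max aemeasurable_const).aestronglyMeasurable
  refine ⟨hu.1.mono hm (ae_of_all _ fun x => ?_),
    hu.2.mono (aestronglyMeasurable_gagliardoQuotient hm) (ae_of_all _ fun z => ?_)⟩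
  · rw [Real.norm_eq_abs, Real.norm_eq_abs, abs_of_nonneg (le_max_right _ _)]
    exact max_le (by linarith [le_abs_self (u x)]) (abs_nonneg _)
  · rw [gagliardoQuotient, gagliardoQuotient, norm_div, norm_div]
    gcongr
    have h := abs_max_sub_max_le_abs (u z.1 - k) (u z.2 - k) 0
    rwa [sub_sub_sub_cancel_right] at h

/-- The map `t ↦ (t - k)₊` is nondecreasing and 1-Lipschitz. -/
theorem max_sub_max_sq_le (a b k : ℝ) :
    (max (a - k) 0 - max (b - k) 0) ^ 2 ≤ (a - b) * (max (a - k) 0 - max (b - k) 0) := by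
  rcases max_cases (a - k) 0 with ⟨h1, h2⟩ | ⟨h1, h2⟩ <;>
    rcases max_cases (b - k) 0 with ⟨h3, h4⟩ | ⟨h3, h4⟩ <;> rw [h1, h3] <;> nlinarith

theorem gagliardoQuotient_max_sub_sq_le (u : EuclideanSpace ℝ (Fin N) → ℝ) (k : ℝ)
    (z : EuclideanSpace ℝ (Fin N) × EuclideanSpace ℝ (Fin N)) :
    gagliardoQuotient s (fun x => max (u x - k) 0) z ^ 2 ≤
      gagliardoQuotient s u z * gagliardoQuotient s (fun x => max (u x - k) 0) z := by
  rw [sq, gagliardoQuotient_mul, gagliardoQuotient_mul, ← sq]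
  gcongr
  exact max_sub_max_sq_le _ _ _

end Truncation

section WeakSolution

variable {N : ℕ} {s q lam : ℝ} {w u : EuclideanSpace ℝ (Fin N) → ℝ}

theorem IsWeakSolution.neg (h : IsWeakSolution s q lam w u) :
    IsWeakSolution s q lam w (fun x => -u x) := by
  refine ⟨h.1.neg, fun φ hφ => ?_⟩
  have h' := congrArg Neg.neg (h.2 φ hφ)
  rw [← integral_neg, ← mul_neg, ← integral_neg] at h'
  convert h' using 3
  · ring
  · funext x
    rw [abs_neg]
    ring

/-- Testing the equation with the truncation `(u - k)₊` bounds its Gagliardo energy. -/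
theorem IsWeakSolution.integral_truncation_sq_le (h : IsWeakSolution s q lam w u) {k : ℝ}
    (hk : 0 ≤ k) :
    ∫ z, gagliardoQuotient s (fun x => max (u x - k) 0) z ^ 2 ∂(volume.prod volume) ≤
      lam * ∫ x, w x * |u x| ^ (q - 2) * u x * max (u x - k) 0 := by
  have hv := h.1.max_sub_zero hk
  rw [← h.2 _ hv]
  refine (integral_mono hv.2.integrable_sq (h.1.2.integrable_mul hv.2)
    fun z => gagliardoQuotient_max_sub_sq_le u k z).trans_eq ?_
  exact integral_congr_ae (ae_of_all _ fun z => gagliardoQuotient_mul _ _ z)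

end WeakSolution

/-! ### Real inequalities behind the iteration. -/

/-- Where the left side is nonzero, the excess `y` over the lower level exceeds the gap `K / T`, so
`K` and `a` are both at most `T * y`. The factor `(T * y / K) ^ (σ - q) ≥ 1` then raises the power
from `q` to `σ`. -/
theorem abs_rpow_mul_max_le {q σ K T : ℝ} (hq : 1 ≤ q) (hqσ : q ≤ σ) (hK : 0 < K) (hT : 2 ≤ T)
    (a : ℝ) :
    |a| ^ (q - 1) * max (a - (K - K / T)) 0 ≤
      T ^ (σ - 1) * K ^ (-(σ - q)) * max (a - (K - 2 * (K / T))) 0 ^ σ := by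
  have hT0 : 0 < T := by linarith
  have hh : 0 < K / T := by positivity
  rcases le_or_gt a (K - K / T) with ha | ha
  · rw [max_eq_right (by linarith), mul_zero]
    positivity
  set y := a - (K - 2 * (K / T)) with hy
  have hyh : K / T < y := by linarith
  have hy0 : 0 < y := hh.trans hyh
  have hKT : K / T * T = K := div_mul_cancel₀ _ hT0.ne'
  have hKy : K ≤ T * y := by nlinarith
  have ha0 : 0 < a := by nlinarith
  have haT : a ≤ T * y := by nlinarith
  rw [max_eq_left (by linarith), max_eq_left hy0.le, abs_of_pos ha0]
  have h1 : 1 ≤ (T * y / K) ^ (σ - q) :=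
    Real.one_le_rpow ((one_le_div hK).2 hKy) (by linarith)
  calc a ^ (q - 1) * (a - (K - K / T))
      ≤ (T * y) ^ (q - 1) * y := by gcongr; linarith
    _ ≤ (T * y) ^ (q - 1) * y * (T * y / K) ^ (σ - q) := le_mul_of_one_le_right (by positivity) h1
    _ = T ^ (σ - 1) * K ^ (-(σ - q)) * y ^ σ := by
        rw [Real.div_rpow (by positivity) hK.le, Real.mul_rpow hT0.le hy0.le,
          Real.mul_rpow hT0.le hy0.le, Real.rpow_neg hK.le,
          show σ - 1 = (q - 1) + (σ - q) by ring, Real.rpow_add hT0]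
        have : y ^ σ = y ^ (q - 1) * y * y ^ (σ - q) := by
          rw [← Real.rpow_add_one hy0.ne', ← Real.rpow_add hy0]; congr 1; ring
        rw [this]
        field_simp

/-- The ratio `θ` is tuned so that the gain `θ ^ (σ - 2)` per step offsets the growth `2 ^ (σ - 1)`
of the coefficient. -/
theorem le_mul_pow_of_sq_le_rpow {Y : ℕ → ℝ} {D U σ θ : ℝ} (hσ : 2 < σ) (hY : ∀ j, 0 ≤ Y j)
    (hD : 0 ≤ D) (hU : 0 < U) (hθ : 0 < θ) (hθσ : θ ^ (σ - 2) * 2 ^ (σ - 1) = 1)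
    (hDθ : D * 2 ^ (σ - 1) * U ^ (σ - 2) ≤ θ ^ 2) (h0 : Y 0 ≤ U)
    (hstep : ∀ j, Y (j + 1) ^ 2 ≤ D * ((2 : ℝ) ^ (j + 1)) ^ (σ - 1) * Y j ^ σ) (j : ℕ) :
    Y j ≤ U * θ ^ j := by
  induction j with
  | zero => simpa using h0
  | succ j ih =>
    have hb : ∀ x : ℝ, 0 < x → x ^ σ = x ^ (σ - 2) * x ^ 2 := fun x hx => by
      rw [← Real.rpow_natCast, ← Real.rpow_add hx]; congr 1; push_cast; ring
    have hpow : ∀ (x y : ℝ) (i : ℕ), 0 ≤ x → (x ^ i) ^ y = (x ^ y) ^ i := fun x y i hx => by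
      rw [← Real.rpow_natCast, ← Real.rpow_natCast, ← Real.rpow_mul hx, ← Real.rpow_mul hx,
        mul_comm]
    refine (sq_le_sq₀ (hY _) (by positivity)).1 ?_
    calc Y (j + 1) ^ 2 ≤ D * ((2 : ℝ) ^ (j + 1)) ^ (σ - 1) * Y j ^ σ := hstep j
      _ ≤ D * ((2 : ℝ) ^ (j + 1)) ^ (σ - 1) * (U * θ ^ j) ^ σ := by
          have := hY j
          gcongr
      _ = D * 2 ^ (σ - 1) * U ^ (σ - 2) * (θ ^ (σ - 2) * 2 ^ (σ - 1)) ^ j * (U * θ ^ j) ^ 2 := by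
          rw [hb _ (by positivity), Real.mul_rpow hU.le (by positivity), hpow _ _ _ hθ.le,
            hpow _ _ _ zero_le_two, pow_succ, mul_pow (θ ^ (σ - 2))]
          ring
      _ ≤ θ ^ 2 * (U * θ ^ j) ^ 2 := by
          rw [hθσ, one_pow, mul_one]
          gcongr
      _ = (U * θ ^ (j + 1)) ^ 2 := by ring

/-! ### De Giorgi iteration and the sup bound. -/

section Regularity

variable {N : ℕ} {s q ν lam : ℝ} {w u : EuclideanSpace ℝ (Fin N) → ℝ}

/-- One step of the De Giorgi iteration between the levels `K - 2K/T` and `K - K/T`. -/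
theorem IsWeakSolution.eLpNorm_truncation_sq_le (hs0 : 0 < s) (hsN : 2 * s < N)
    (h : IsWeakSolution s q lam w u) (hq : 2 < q) {τ L A K T : ℝ} (hτ : 1 < τ)
    (hqτ : q ≤ critExp N s * (1 - 1 / τ)) (hw : AEStronglyMeasurable w)
    (hlam : 0 ≤ lam) (hL : lam ≤ L) (hA : 0 ≤ A)
    (hwA : eLpNorm w (ENNReal.ofReal τ) volume ≤ ENNReal.ofReal A) (hK : 0 < K) (hT : 2 ≤ T) :
    (eLpNorm (fun x => max (u x - (K - K / T)) 0)
        (ENNReal.ofReal (critExp N s)) volume).toReal ^ 2 ≤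
      sobolevConst N s * L * A * K ^ (-(critExp N s * (1 - 1 / τ) - q)) *
        T ^ (critExp N s * (1 - 1 / τ) - 1) *
        (eLpNorm (fun x => max (u x - (K - 2 * (K / T))) 0)
          (ENNReal.ofReal (critExp N s)) volume).toReal ^ (critExp N s * (1 - 1 / τ)) := by
  have hT0 : 0 < T := by linarith
  have hKT : K / T * T = K := div_mul_cancel₀ _ hT0.ne'
  have hh : 0 < K / T := by positivity
  have hk : 0 ≤ K - 2 * (K / T) := by nlinarith
  have hk' : 0 ≤ K - K / T := by linarith
  have hp := two_lt_critExp hs0 hsN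
  have hS := sobolevConst_pos N s
  have hL0 : 0 ≤ L := hlam.trans hL
  have hv := h.1.max_sub_zero hk'
  have hv₀ := h.1.max_sub_zero hk
  set p := critExp N s with hpdef
  set σ := p * (1 - 1 / τ) with hσ
  set V := (eLpNorm (fun x => max (u x - (K - 2 * (K / T))) 0)
    (ENNReal.ofReal p) volume).toReal with hV
  have hVE : eLpNorm (fun x => max (u x - (K - 2 * (K / T))) 0) (ENNReal.ofReal p) volume =
      ENNReal.ofReal V := (ENNReal.ofReal_toReal hv₀.1.eLpNorm_ne_top).symm
  have hV0 : 0 ≤ V := ENNReal.toReal_nonneg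
  set c := T ^ (σ - 1) * K ^ (-(σ - q)) with hc
  have hc0 : 0 ≤ c := by positivity
  have hrhs : ∫ x, w x * |u x| ^ (q - 2) * u x * max (u x - (K - K / T)) 0 ≤
      c * (A * V ^ σ) := by
    refine (Real.le_norm_self _).trans ?_
    rw [← ENNReal.ofReal_le_ofReal_iff (by positivity), ofReal_norm]
    refine (enorm_integral_le_lintegral_enorm _).trans ?_
    calc ∫⁻ x, ‖w x * |u x| ^ (q - 2) * u x * max (u x - (K - K / T)) 0‖ₑ
        ≤ ∫⁻ x, ENNReal.ofReal c *
            (‖w x‖ₑ * ‖max (u x - (K - 2 * (K / T))) 0‖ₑ ^ σ) := by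
          refine lintegral_mono fun x => ?_
          have hpt := abs_rpow_mul_max_le (by linarith) hqτ hK hT (u x)
          have he : |u x| ^ (q - 2) * |u x| = |u x| ^ (q - 1) := by
            rw [← Real.rpow_add_one' (abs_nonneg _) (by linarith)]; congr 1; ring
          have hb : ‖max (u x - (K - 2 * (K / T))) 0‖ₑ =
              ENNReal.ofReal (max (u x - (K - 2 * (K / T))) 0) := by
            rw [Real.enorm_eq_ofReal_abs, abs_of_nonneg (le_max_right _ _)]
          rw [hb, ENNReal.ofReal_rpow_of_nonneg (le_max_right _ _) (by linarith),
            Real.enorm_eq_ofReal_abs, Real.enorm_eq_ofReal_abs,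
            ← ENNReal.ofReal_mul (abs_nonneg _), ← ENNReal.ofReal_mul hc0]
          refine ENNReal.ofReal_le_ofReal ?_
          rw [abs_mul, abs_mul, abs_mul, abs_of_nonneg (le_max_right (u x - (K - K / T)) 0),
            abs_of_nonneg (by positivity : 0 ≤ |u x| ^ (q - 2)), mul_assoc |w x|, he,
            mul_assoc, mul_left_comm c]
          exact mul_le_mul_of_nonneg_left hpt (abs_nonneg _)
      _ ≤ ENNReal.ofReal c * (ENNReal.ofReal A * ENNReal.ofReal V ^ σ) := by
          rw [lintegral_const_mul' _ _ ENNReal.ofReal_ne_top]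
          gcongr
          refine (lintegral_enorm_mul_enorm_rpow_le hw hv₀.1.1 (by linarith) hτ).trans ?_
          rw [hVE]
          gcongr
      _ = ENNReal.ofReal (c * (A * V ^ σ)) := by
          rw [ENNReal.ofReal_mul hc0, ENNReal.ofReal_mul hA,
            ENNReal.ofReal_rpow_of_nonneg hV0 (by linarith)]
  calc _ ≤ sobolevConst N s * ∫ z, gagliardoQuotient s
            (fun x => max (u x - (K - K / T)) 0) z ^ 2 ∂(volume.prod volume) :=
        hv.eLpNorm_sq_le hs0 hsN
    _ ≤ sobolevConst N s * (lam * (c * (A * V ^ σ))) := by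
        refine mul_le_mul_of_nonneg_left ((h.integral_truncation_sq_le hk').trans ?_) hS.le
        exact mul_le_mul_of_nonneg_left hrhs hlam
    _ ≤ sobolevConst N s * (L * (c * (A * V ^ σ))) := by gcongr
    _ = _ := by rw [hc]; ring

/-- If `M` is large enough, the levels `M ‖u‖ (1 - 2⁻ʲ)` give `u ≤ M ‖u‖`. -/
theorem IsWeakSolution.ae_le_mul_eLpNorm (hs0 : 0 < s) (hsN : 2 * s < N)
    (h : IsWeakSolution s q lam w u) (hq : 2 < q) {τ L A B M θ : ℝ} (hτ : 1 < τ)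
    (hqτ : q < critExp N s * (1 - 1 / τ)) (hw : AEStronglyMeasurable w)
    (hlam : 0 ≤ lam) (hL : lam ≤ L) (hA : 0 ≤ A)
    (hwA : eLpNorm w (ENNReal.ofReal τ) volume ≤ ENNReal.ofReal A)
    (huB : (eLpNorm u (ENNReal.ofReal (critExp N s)) volume).toReal ≤ B)
    (hθ : 0 < θ) (hθ1 : θ < 1)
    (hθσ : θ ^ (critExp N s * (1 - 1 / τ) - 2) * 2 ^ (critExp N s * (1 - 1 / τ) - 1) = 1)
    (hM : 0 < M)
    (hMθ : sobolevConst N s * L * A * 2 ^ (critExp N s * (1 - 1 / τ) - 1) * B ^ (q - 2) ≤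
      θ ^ 2 * M ^ (critExp N s * (1 - 1 / τ) - q)) :
    ∀ᵐ x, u x ≤ M * (eLpNorm u (ENNReal.ofReal (critExp N s)) volume).toReal := by
  have hp := two_lt_critExp hs0 hsN
  have hS := sobolevConst_pos N s
  have hL0 : 0 ≤ L := hlam.trans hL
  have hp0 : ENNReal.ofReal (critExp N s) ≠ 0 := by
    simp only [ne_eq, ENNReal.ofReal_eq_zero, not_le]; linarith
  have hstep := fun K (hK : 0 < K) T (hT : 2 ≤ T) =>
    h.eLpNorm_truncation_sq_le hs0 hsN hq hτ hqτ.le hw hlam hL hA hwA hK hT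
  set p := critExp N s with hpdef
  set σ := p * (1 - 1 / τ) with hσ
  obtain ⟨U, hU⟩ : ∃ U, U = (eLpNorm u (ENNReal.ofReal p) volume).toReal := ⟨_, rfl⟩
  rw [← hU] at huB ⊢
  have hU0 : 0 ≤ U := hU ▸ ENNReal.toReal_nonneg
  rcases hU0.eq_or_lt with h0 | hUpos
  · have hz : eLpNorm u (ENNReal.ofReal p) volume = 0 := by
      have := (ENNReal.toReal_eq_zero_iff _).1 (hU.symm.trans h0.symm)
      exact this.resolve_right h.1.1.eLpNorm_ne_top
    filter_upwards [(eLpNorm_eq_zero_iff h.1.1.1 hp0).1 hz] with x hx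
    rw [hx, ← h0, mul_zero]; rfl
  have hK : 0 < M * U := by positivity
  set K := M * U with hKdef
  have hlev : ∀ j : ℕ, 0 ≤ K - K / 2 ^ j := fun j => by
    have : K / 2 ^ j ≤ K := div_le_self hK.le (one_le_pow₀ one_le_two)
    linarith
  set Y : ℕ → ℝ := fun j =>
    (eLpNorm (fun x => max (u x - (K - K / 2 ^ j)) 0) (ENNReal.ofReal p) volume).toReal with hY
  have hY0 : Y 0 ≤ U := by
    rw [hU]
    refine ENNReal.toReal_mono h.1.1.eLpNorm_ne_top (eLpNorm_mono fun x => ?_)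
    rw [Real.norm_eq_abs, Real.norm_eq_abs, abs_of_nonneg (le_max_right _ _)]
    exact max_le (by simpa using le_abs_self (u x)) (abs_nonneg _)
  have hbound := le_mul_pow_of_sq_le_rpow (Y := Y)
    (D := sobolevConst N s * L * A * K ^ (-(σ - q))) (by linarith : 2 < σ)
    (fun j => ENNReal.toReal_nonneg) (by positivity) hUpos hθ hθσ (by
      -- The factor `U ^ (σ - q)` cancels against `K = M * U`, leaving `U ^ (q - 2) ≤ B ^ (q - 2)`;
      -- hence `M` depends on `U` only through `B`.
      have e1 : U ^ (σ - 2) = U ^ (q - 2) * U ^ (σ - q) := by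
        rw [← Real.rpow_add hUpos]; congr 1; ring
      rw [hKdef, Real.rpow_neg hK.le, Real.mul_rpow hM.le hUpos.le, e1]
      have e2 : sobolevConst N s * L * A * (M ^ (σ - q) * U ^ (σ - q))⁻¹ * 2 ^ (σ - 1) *
          (U ^ (q - 2) * U ^ (σ - q)) =
          sobolevConst N s * L * A * 2 ^ (σ - 1) * U ^ (q - 2) / M ^ (σ - q) := by
        field_simp
      rw [e2, div_le_iff₀ (by positivity)]
      refine le_trans ?_ hMθ
      gcongr) hY0 (fun j => by
      -- With `T = 2 ^ (j + 1)` the two levels are those of `Y j` and `Y (j + 1)`.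
      have h1 := hstep K hK (2 ^ (j + 1))
        (by rw [pow_succ]; linarith [one_le_pow₀ (n := j) (one_le_two (α := ℝ))])
      have e : 2 * (K / 2 ^ (j + 1)) = K / 2 ^ j := by rw [pow_succ]; field_simp
      rw [e] at h1
      exact h1)
  have hv := h.1.max_sub_zero hK.le
  -- All levels lie below `K`, so `(u - K)₊` is dominated by every truncation.
  have hle : ∀ j : ℕ, (eLpNorm (fun x => max (u x - K) 0) (ENNReal.ofReal p) volume).toReal ≤
      U * θ ^ j := fun j => by
    refine le_trans ?_ (hbound j)
    refine ENNReal.toReal_mono (h.1.max_sub_zero (hlev j)).1.eLpNorm_ne_top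
      (eLpNorm_mono fun x => ?_)
    rw [Real.norm_eq_abs, Real.norm_eq_abs, abs_of_nonneg (le_max_right _ _),
      abs_of_nonneg (le_max_right _ _)]
    have : 0 ≤ K / 2 ^ j := by positivity
    gcongr
    linarith
  have hlim : Filter.Tendsto (fun j : ℕ => U * θ ^ j) Filter.atTop (nhds 0) := by
    simpa using (tendsto_pow_atTop_nhds_zero_of_lt_one hθ.le hθ1).const_mul U
  have hzero := le_antisymm (ge_of_tendsto' hlim hle) ENNReal.toReal_nonneg
  have hz := ((ENNReal.toReal_eq_zero_iff _).1 hzero).resolve_right hv.1.eLpNorm_ne_top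
  filter_upwards [(eLpNorm_eq_zero_iff hv.1.1 hp0).1 hz] with x hx
  have hx' : max (u x - K) 0 = 0 := hx
  linarith [le_max_left (u x - K) 0]

theorem one_lt_weightExpHigh (hq2 : 2 < q) (hq : q < critExp N s) (hqν : q < ν) :
    1 < weightExpHigh N s q ν := by
  have h1 : 1 < ν / (ν - 1) := by rw [one_lt_div (by linarith)]; linarith
  have h2 : 1 < weightExpLow N s q := by
    rw [weightExpLow, one_lt_div (by linarith)]; linarith
  exact one_lt_mul_of_lt_of_le h1 h2.le

/-- The strict gap makes `M ^ (σ - q)` unbounded in `M`; at `weightExpLow` the exponent would be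
exactly `q`. -/
theorem lt_critExp_mul_one_sub (hq2 : 2 < q) (hq : q < critExp N s) (hqν : q < ν) :
    q < critExp N s * (1 - 1 / weightExpHigh N s q ν) := by
  have hp : 0 < critExp N s := by linarith
  have hpq : 0 < critExp N s - q := by linarith
  have hν : 0 < ν := by linarith
  have hν1 : 0 < ν - 1 := by linarith
  have e : critExp N s * (1 - 1 / weightExpHigh N s q ν) - q = (critExp N s - q) / ν := by
    rw [weightExpHigh, weightExpLow]
    field_simp
    ring
  have : 0 < (critExp N s - q) / ν := by positivity
  linarith

theorem weightExpHigh_mem_Icc (hq2 : 2 < q) (hq : q < critExp N s) (hqν : q < ν) :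
    weightExpHigh N s q ν ∈ Set.Icc (weightExpLow N s q) (weightExpHigh N s q ν) := by
  refine ⟨?_, le_rfl⟩
  have h1 : 1 ≤ ν / (ν - 1) := by rw [one_le_div (by linarith)]; linarith
  have h2 : 0 ≤ weightExpLow N s q := div_nonneg (by linarith) (by linarith)
  exact le_mul_of_one_le_left h2 h1

theorem exists_eLpNorm_top_le (hs0 : 0 < s) (hsN : 2 * s < N) (hq2 : 2 < q)
    (hq : q < critExp N s) (hqν : q < ν) (L A B : ℝ≥0) :
    ∃ C : ℝ≥0, ∀ w : EuclideanSpace ℝ (Fin N) → ℝ, WeightIntegrability s q ν w →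
      eLpNorm w (ENNReal.ofReal (weightExpHigh N s q ν)) volume ≤ A →
      ∀ lam : ℝ, 0 < lam → lam ≤ L →
      ∀ u : EuclideanSpace ℝ (Fin N) → ℝ, IsWeakSolution s q lam w u →
        eLpNorm u (ENNReal.ofReal (critExp N s)) volume ≤ B →
        eLpNorm u ∞ volume ≤ C * eLpNorm u (ENNReal.ofReal (critExp N s)) volume := by
  have hτ := one_lt_weightExpHigh hq2 hq hqν
  have hqτ := lt_critExp_mul_one_sub hq2 hq hqν
  have hmem := weightExpHigh_mem_Icc hq2 hq hqν
  have hS := sobolevConst_pos N s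
  set τ := weightExpHigh N s q ν with hτdef
  obtain ⟨σ, hσ⟩ : ∃ σ, σ = critExp N s * (1 - 1 / τ) := ⟨_, rfl⟩
  rw [← hσ] at hqτ
  have hσ2 : 0 < σ - 2 := by linarith
  have hσq : 0 < σ - q := by linarith
  set θ : ℝ := 2 ^ (-((σ - 1) / (σ - 2))) with hθdef
  have hθ : 0 < θ := by positivity
  have hθ1 : θ < 1 := Real.rpow_lt_one_of_one_lt_of_neg one_lt_two
    (neg_lt_zero.2 (div_pos (by linarith) hσ2))
  have hθσ : θ ^ (σ - 2) * 2 ^ (σ - 1) = 1 := by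
    rw [hθdef, ← Real.rpow_mul zero_le_two, ← Real.rpow_add two_pos, neg_mul,
      div_mul_cancel₀ _ hσ2.ne', neg_add_cancel, Real.rpow_zero]
  set Q := sobolevConst N s * L * A * 2 ^ (σ - 1) * (B : ℝ) ^ (q - 2) with hQ
  have hQ0 : 0 ≤ Q := by positivity
  -- The summand `1` keeps `M` positive when `Q = 0`.
  set M := (Q / θ ^ 2 + 1) ^ (1 / (σ - q)) with hMdef
  have hM : 0 < M := by positivity
  have hMθ : Q ≤ θ ^ 2 * M ^ (σ - q) := by
    rw [hMdef, ← Real.rpow_mul (by positivity), one_div_mul_cancel hσq.ne', Real.rpow_one,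
      mul_add, mul_div_cancel₀ _ (by positivity)]
    have : 0 < θ ^ 2 := by positivity
    linarith
  refine ⟨M.toNNReal, fun w hw hwA lam hlam hlamL u hu huB => ?_⟩
  have hwA' : eLpNorm w (ENNReal.ofReal τ) volume ≤ ENNReal.ofReal (A : ℝ) := by
    rwa [ENNReal.ofReal_coe_nnreal]
  have huB' : (eLpNorm u (ENNReal.ofReal (critExp N s)) volume).toReal ≤ B :=
    ENNReal.toReal_le_coe_of_le_coe huB
  have hneg : eLpNorm (fun x => -u x) (ENNReal.ofReal (critExp N s)) volume =
      eLpNorm u (ENNReal.ofReal (critExp N s)) volume := eLpNorm_neg u _ _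
  rw [hσ] at hqτ hθσ hMθ hQ
  rw [hQ] at hMθ
  have hup := hu.ae_le_mul_eLpNorm hs0 hsN hq2 hτ hqτ (hw τ hmem).1 hlam.le hlamL A.2 hwA' huB'
    hθ hθ1 hθσ hM hMθ
  have hlow := hu.neg.ae_le_mul_eLpNorm hs0 hsN hq2 hτ hqτ (hw τ hmem).1 hlam.le hlamL A.2 hwA'
    (by rwa [hneg]) hθ hθ1 hθσ hM hMθ
  rw [hneg] at hlow
  rw [eLpNorm_exponent_top]
  refine (eLpNormEssSup_le_of_ae_bound (C := M *
    (eLpNorm u (ENNReal.ofReal (critExp N s)) volume).toReal) ?_).trans (le_of_eq ?_)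
  · filter_upwards [hup, hlow] with x h1 h2
    exact abs_le.2 ⟨by linarith, h1⟩
  · rw [ENNReal.ofReal_mul hM.le, ENNReal.ofReal_toReal hu.1.1.eLpNorm_ne_top]
    rfl

end Regularity

/-! ### Interpolation and conclusion. -/

theorem MemLp.of_le_of_top {α : Type*} [MeasurableSpace α] {μ : Measure α} {f : α → ℝ} {p : ℝ}
    (hp : 0 < p) (hf : MemLp f (ENNReal.ofReal p) μ) (hf' : MemLp f ∞ μ) {κ : ℝ≥0∞}
    (hκ : ENNReal.ofReal p ≤ κ) : MemLp f κ μ := by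
  rcases eq_or_ne κ ∞ with rfl | hκtop
  · exact hf'
  have hp0 : ENNReal.ofReal p ≠ 0 := by simpa using hp
  have hκ0 : κ ≠ 0 := (lt_of_lt_of_le (pos_iff_ne_zero.2 hp0) hκ).ne'
  have hpκ : p ≤ κ.toReal := (ENNReal.ofReal_le_iff_le_toReal hκtop).1 hκ
  refine ⟨hf.1, ?_⟩
  rw [eLpNorm_lt_top_iff_lintegral_rpow_enorm_lt_top hκ0 hκtop]
  have hess : eLpNormEssSup f μ ≠ ∞ := by
    rw [← eLpNorm_exponent_top]; exact hf'.eLpNorm_ne_top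
  calc ∫⁻ x, ‖f x‖ₑ ^ κ.toReal ∂μ
      ≤ ∫⁻ x, eLpNormEssSup f μ ^ (κ.toReal - p) * ‖f x‖ₑ ^ p ∂μ := by
        refine lintegral_mono_ae ?_
        filter_upwards [enorm_ae_le_eLpNormEssSup f μ] with x hx
        rw [show κ.toReal = (κ.toReal - p) + p by ring,
          ENNReal.rpow_add_of_nonneg _ _ (by linarith) hp.le, add_sub_cancel_right]
        gcongr
    _ = eLpNormEssSup f μ ^ (κ.toReal - p) * eLpNorm f (ENNReal.ofReal p) μ ^ p := by
        rw [lintegral_const_mul' _ _ (ENNReal.rpow_ne_top_of_nonneg (by linarith) hess),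
          lintegral_enorm_rpow_eq_eLpNorm_rpow f hp]
    _ < ∞ := ENNReal.mul_lt_top (ENNReal.rpow_lt_top_of_nonneg (by linarith) hess)
        (ENNReal.rpow_lt_top_of_nonneg hp.le hf.eLpNorm_ne_top)

theorem theorem2 {N : ℕ} {s q ν : ℝ} (hs0 : 0 < s) (hs1 : s < 1) (hsN : 2 * s < N)
    (hq2 : 2 < q) (hq : q < critExp N s) (hqν : q < ν) (hν : ν < critExp N s) :
    (∀ w : EuclideanSpace ℝ (Fin N) → ℝ, WeightPosOnOpen w → WeightIntegrability s q ν w →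
      ∀ lam : ℝ, 0 < lam → ∀ u : EuclideanSpace ℝ (Fin N) → ℝ, IsWeakSolution s q lam w u →
        ∀ κ : ℝ≥0∞, ENNReal.ofReal (critExp N s) ≤ κ → MemLp u κ volume) ∧
    (∀ L A B : ℝ≥0, ∃ C : ℝ≥0,
      ∀ w : EuclideanSpace ℝ (Fin N) → ℝ, WeightPosOnOpen w → WeightIntegrability s q ν w →
        eLpNorm w (ENNReal.ofReal (weightExpHigh N s q ν)) volume ≤ A →
      ∀ lam : ℝ, 0 < lam → lam ≤ L →
      ∀ u : EuclideanSpace ℝ (Fin N) → ℝ, IsWeakSolution s q lam w u →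
        eLpNorm u (ENNReal.ofReal (critExp N s)) volume ≤ B →
        eLpNorm u ∞ volume ≤ C * eLpNorm u (ENNReal.ofReal (critExp N s)) volume) := by
  refine ⟨fun w _ hw lam hlam u hu κ hκ => ?_, fun L A B => ?_⟩
  · have hwτ := hw _ (weightExpHigh_mem_Icc hq2 hq hqν)
    -- For a single solution, `lam` and the two finite norms serve as their own bounds.
    obtain ⟨C, hC⟩ := exists_eLpNorm_top_le hs0 hsN hq2 hq hqν lam.toNNReal
      (eLpNorm w (ENNReal.ofReal (weightExpHigh N s q ν)) volume).toNNReal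
      (eLpNorm u (ENNReal.ofReal (critExp N s)) volume).toNNReal
    have h := hC w hw (ENNReal.coe_toNNReal hwτ.eLpNorm_ne_top).ge lam hlam
      (Real.le_coe_toNNReal lam) u hu (ENNReal.coe_toNNReal hu.1.1.eLpNorm_ne_top).ge
    exact MemLp.of_le_of_top (by linarith) hu.1.1
      ⟨hu.1.1.1, h.trans_lt (ENNReal.mul_lt_top ENNReal.coe_lt_top hu.1.1.eLpNorm_lt_top)⟩ hκ
  · obtain ⟨C, hC⟩ := exists_eLpNorm_top_le hs0 hsN hq2 hq hqν L A B
    exact ⟨C, fun w _ => hC w⟩
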